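/- Let $G=(V,E)$ be a finite simple graph with $n$ nodes. For $S\subseteq V$ let $\delta_G(S)$ be the number of edges between $S$ and $V\setminus S$, and $\mathrm{vol}_G(S)$ the number of edges incident to $S$. $G$ is a $\phi$-expander if $\delta_G(S)/\min\{\mathrm{vol}_G(S),\mathrm{vol}_G(V\setminus S)\}\ge\phi$ for every $S\subseteq V$ such that $S$ and $V\setminus S$ have positive volume. In the adversarial CONGEST model the nodes have unique identifiers, communicate in synchronous rounds by messages of $O(\log n)$ bits over the edges of $G$, and have private independent coins. Initially a node knows only the identifiers of its incident edges, a number $t\ge 1$, and a polynomial estimate $N$ of $n$, $n\le N\le n^{a}$. An adversary that knows the graph, the algorithm and all coins controls a fixed set $F\subseteq E$ of at most $t$ edges, unknown to the nodes, and sends arbitrary messages over the edges of $F$ in both directions. Consider the following algorithm, which uses no communication rounds, with parameters $c_p,C_\ell>0$: for each $i=1,\dots,\ell$, where $\ell=\lceil C_\ell\, t\log N\rceil$, every node $v$ samples each of its incoming directed edges $(u,v)$, $\{u,v\}\in E$, independently with probability $p=\min\{1,c_p/t\}$. Let $G_i$ be the directed graph on $V$ formed by the directed edges sampled for the index $i$;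 the node $v$ thus knows which of its incoming edges belong to $G_i$. **Lemma (Directed covering families for expanders).** For all $a\ge1$ and $c>0$ there are constants $C_{\deg},c_p,C_\ell,C_{\mathrm{num}},C_L>0$, depending only on $a$ and $c$, such that the following holds for every $t\ge1$, every $\phi>0$, every $n$-node $\phi$-expander $G$ of minimum degree at least $C_{\deg}\,t^2\log n/\phi$, and every $N$ with $n\le N\le n^a$. The number of subgraphs satisfies $\ell\le C_{\mathrm{num}}\,t\log n$. Moreover, for every set $F\subseteq E$ of at most $t$ adversarial edges and every strategy of the adversary, with probability at least $1-n^{-c}$ the outputs of the algorithm describe directed subgraphs $G_1,\dots,G_\ell$ of $G$ such that for all $u,v\in V$ and every $E'\subseteq E$ with $|E'|\le 2t$ there is an $i$ with (P1') $\mathrm{dist}_{G_i}(u,v)\le C_L\log n/\phi$ (directed distance), and (P2) $G_i$ contains no edge of $E'$ in either direction. -/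

import Mathlib

open MeasureTheory ProbabilityTheory

universe u

noncomputable section

namespace AdvCongest

/-! ### Expanders -/

/-- `δ_G(S)`: the number of edges of `G` crossing the cut `(S, V \ S)`. -/
def cutSize {V : Type*} (G : SimpleGraph V) (S : Set V) : ℕ :=
  {e ∈ G.edgeSet | (∃ x ∈ S, x ∈ e) ∧ ∃ y ∈ Sᶜ, y ∈ e}.ncard

/-- `vol_G(S)`: the number of edges of `G` incident to `S`. -/
def vol {V : Type*} (G : SimpleGraph V) (S : Set V) : ℕ :=
  {e ∈ G.edgeSet | ∃ x ∈ S, x ∈ e}.ncard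

/-- `φ_G(S) = δ_G(S) / min {vol_G(S), vol_G(V \ S)}`, meaningful if both volumes are positive. -/
def conductance {V : Type*} (G : SimpleGraph V) (S : Set V) : ℝ :=
  (cutSize G S : ℝ) / (min (vol G S) (vol G Sᶜ) : ℕ)

/-- `G` is a `φ`-expander: every cut whose two sides have positive volume has conductance at
least `φ`. -/
def IsExpander {V : Type*} (G : SimpleGraph V) (φ : ℝ) : Prop :=
  ∀ S : Set V, 0 < vol G S → 0 < vol G Sᶜ → φ ≤ conductance G S

/-! ### Directed covering families -/

/-- `DiWalk D k u v`: the digraph `D` has a directed walk with `k` edges from `u` to `v`. -/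
inductive DiWalk {V : Type*} (D : Digraph V) : ℕ → V → V → Prop
  | nil (u : V) : DiWalk D 0 u u
  | cons {k : ℕ} {u v w : V} (h : D.Adj u v) (p : DiWalk D k v w) : DiWalk D (k + 1) u w

/-- The directed distance from `u` to `v` (`⊤` if `v` is not reachable from `u`). -/
def diDist {V : Type*} (D : Digraph V) (u v : V) : ℕ∞ :=
  ⨅ (k : ℕ) (_ : DiWalk D k u v), (k : ℕ∞)

/-- The family `D` consists of directed subgraphs of `G` and, for all nodes `u, v` and every set
`E'` of at most `k` edges of `G`, it has a member in which `v` is at directed distance at most `L`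
from `u` and which contains no edge of `E'`, in neither direction. -/
def IsDirectedCoveringFamily {V ι : Type*} (G : SimpleGraph V) (L : ℝ) (k : ℕ)
    (D : ι → Digraph V) : Prop :=
  (∀ i u v, (D i).Adj u v → G.Adj u v) ∧
  ∀ (u v : V) (E' : Finset (Sym2 V)), (E' : Set (Sym2 V)) ⊆ G.edgeSet → E'.card ≤ k →
    ∃ i, (∃ d : ℕ, diDist (D i) u v = d ∧ (d : ℝ) ≤ L) ∧
      ∀ x y, s(x, y) ∈ E' → ¬ (D i).Adj x y ∧ ¬ (D i).Adj y x

/-! ### The adversarial CONGEST model -/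

/-- What a processor knows about the graph initially: its own identifier and the identifiers of
its neighbours, hence those of its incident edges. -/
structure View where
  id : ℕ
  nbrs : Finset ℕ

/-- The initial view of node `v` in the graph `G` with unique identifiers `ident`. -/
def view {V : Type*} [Fintype V] (G : SimpleGraph V) [DecidableRel G.Adj] (ident : V ↪ ℕ)
    (v : V) : View :=
  ⟨ident v, (G.neighborFinset v).map ident⟩

/-- A randomized synchronous message-passing algorithm with messages of `b` bits. A node tosses
private coins and enters an initial state; in each round it sends a message to every neighbour
(addressed by its identifier), receives the messages of its neighbours (tagged by the identifier
of the sender) and updates its state; after the last round it produces its output.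
Global parameters known to all nodes may enter the algorithm. -/
structure Algorithm (b : ℕ) (Out : Type) where
  Coin : View → Type
  coinSpace : ∀ w, MeasurableSpace (Coin w)
  law : ∀ w, Measure (Coin w)
  isProb : ∀ w, IsProbabilityMeasure (law w)
  State : Type
  init : ∀ w, Coin w → State
  send : State → ℕ → BitVec b
  recv : State → Finset (ℕ × BitVec b) → State
  rounds : ℕ
  output : State → Out

attribute [instance] Algorithm.coinSpace Algorithm.isProb

namespace Algorithm

variable {b : ℕ} {Out : Type} (A : Algorithm b Out) {V : Type*} [Fintype V]
  (G : SimpleGraph V) [DecidableRel G.Adj] (ident : V ↪ ℕ)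

/-- The private coins of all nodes. -/
abbrev Coins : Type _ := ∀ v : V, A.Coin (view G ident v)

/-- The joint law of the private coins: the nodes toss them independently. -/
def coinsLaw : Measure (A.Coins G ident) :=
  Measure.pi fun v => A.law (view G ident v)

/-- A strategy of the adversary: the message put on an adversarial edge in a given round and a
given direction. The adversary is computationally unbounded and knows the graph, the algorithm and
the coins of all nodes, so that the messages exchanged so far are determined by what it knows. -/
abbrev Adversary : Type _ := A.Coins G ident → ℕ → V → V → BitVec b

open Classical in
/-- The state of node `v` after `r` rounds, if the adversary controls the edges in `F`. -/
def stateAt (F : Finset (Sym2 V)) (adv : A.Adversary G ident) (ω : A.Coins G ident) :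
    ℕ → V → A.State
  | 0, v => A.init (view G ident v) (ω v)
  | r + 1, v => A.recv (stateAt F adv ω r v) ((G.neighborFinset v).image fun u =>
      (ident u, if s(u, v) ∈ F then adv ω r u v else A.send (stateAt F adv ω r u) (ident v)))

/-- The output of node `v`, if the adversary controls the edges in `F`. -/
def outputAt (F : Finset (Sym2 V)) (adv : A.Adversary G ident) (ω : A.Coins G ident) (v : V) :
    Out :=
  A.output (A.stateAt G ident F adv ω A.rounds v)

end Algorithm

/-- The directed graphs described by local outputs: for every index `i` a node `v` outputs the
identifiers of those `u` for which the directed edge `(u, v)` belongs to the `i`-th graph. -/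
def outputFamily {V : Type*} (ident : V ↪ ℕ) {l : ℕ} (out : V → Fin l → Finset ℕ) (i : Fin l) :
    Digraph V where
  Adj u v := ident u ∈ out v i

/-! ### The sampling algorithm -/

/-- The sampling probability `min {1, cp / t}`. -/
def rate (cp : ℝ) (t : ℕ) : unitInterval :=
  Set.projIcc 0 1 zero_le_one (cp / t)

/-- The number `⌈Cl * t * log N⌉` of sampled subgraphs. -/
def numSubgraphs (Cl : ℝ) (N t : ℕ) : ℕ := ⌈Cl * t * Real.log N⌉₊

/-- The algorithm without communication in which every node, for each of the `numSubgraphs Cl N t`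
indices and for each of its incoming directed edges, independently samples this edge with
probability `rate cp t`. It uses only the bound `t` on the number of adversarial edges and the
estimate `N` of the number of nodes. -/
def sampling (cp Cl : ℝ) (N t : ℕ) :
    Algorithm (Nat.clog 2 N) (Fin (numSubgraphs Cl N t) → Finset ℕ) where
  Coin w := Fin (numSubgraphs Cl N t) → w.nbrs → Bool
  coinSpace _ := inferInstance
  law _ := Measure.pi fun _ => Measure.pi fun _ => bernoulliMeasure true false (rate cp t)
  isProb _ := inferInstance
  State := Fin (numSubgraphs Cl N t) → Finset ℕ
  init w coin i := (w.nbrs.attach.filter fun x => coin i x = true).map (Function.Embedding.subtype _)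
  send _ _ := 0
  recv s _ := s
  rounds := 0
  output s := s

end AdvCongest

end

/-! No messages are exchanged, so the adversary cannot influence the outputs, and the claim concerns
random digraphs only. Fix `E'` with at most `2t` edges and sample with rate `1/(16t)`. One sampled
digraph meets `E'` with probability at most `4t/(16t) = 1/4`. It also has directed expansion in both
directions except with probability `1/16 + 1/16`, so it is good for `E'` with probability at least
`1/2`. The samples are independent, so none is good with probability at most `2^(-ℓ)`. A union bound
over the at most `e * n^(4t)` sets `E'` costs only a constant factor in `ℓ ≈ t log n`.

The notion of expansion is chosen to force ball growth: for all `S` of at most half the total degree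
and all light `T`, some sampled edge leaves `S ∪ T`. If `S` is a ball and `T` its next layer, no
such edge exists, so `T` is heavy and the degree sum grows by the factor `1 + φ/4`. After `O(log n /
φ)` steps the forward ball of `u` and the backward ball of `v` both exceed half the total degree,
hence meet.

Expansion survives sampling because `Ω(φ * degSum S)` edges of `G` leave `S ∪ T`. The minimum degree
makes the probability of missing them all at most `n^(-8(|S| + |T|))`, which is summable over all
pairs `(S, T)` (`HasAvoidanceProb.measureReal_not_expands_le`). -/

namespace AdvCongest

/-! ### Degree sums and cuts -/

section DegreeSums

variable {V : Type*} [Fintype V] (G : SimpleGraph V) [DecidableRel G.Adj]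

/-- The sum of the degrees of the nodes in `S`. -/
def degSum (S : Finset V) : ℕ := ∑ v ∈ S, G.degree v

/-- The ordered pairs of adjacent nodes whose first node lies in `S`. -/
def pairsFrom (S : Finset V) : Finset (V × V) :=
  (S ×ˢ Finset.univ).filter fun e => G.Adj e.1 e.2

theorem card_pairsFrom (S : Finset V) : (pairsFrom G S).card = degSum G S := by
  rw [pairsFrom, Finset.card_filter, Finset.sum_product, degSum]
  refine Finset.sum_congr rfl fun v _ => ?_
  rw [← Finset.card_filter, ← SimpleGraph.card_neighborFinset_eq_degree,
    SimpleGraph.neighborFinset_eq_filter]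

theorem degSum_le_two_mul_vol (S : Finset V) : degSum G S ≤ 2 * vol G S := by
  classical
  rw [← card_pairsFrom]
  have h : (pairsFrom G S).card ≤
      2 * ((pairsFrom G S).image fun e => s(e.1, e.2)).card := by
    refine Finset.card_le_mul_card_image _ 2 fun e _ => ?_
    induction e with
    | _ x y =>
      refine (Finset.card_le_card (t := {(x, y), (y, x)}) fun f hf => ?_).trans Finset.card_le_two
      simp only [Finset.mem_filter, Sym2.eq_iff] at hf
      simp only [Finset.mem_insert, Finset.mem_singleton, Prod.ext_iff]
      exact hf.2
  refine h.trans (Nat.mul_le_mul_left 2 ?_)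
  rw [vol, ← Set.ncard_coe_finset]
  refine Set.ncard_le_ncard ?_ (Set.toFinite _)
  intro e he
  simp only [pairsFrom, Finset.coe_image, Set.mem_image, Finset.mem_coe, Finset.mem_filter,
    Finset.mem_product] at he
  obtain ⟨f, ⟨⟨hf, _⟩, ha⟩, rfl⟩ := he
  exact ⟨ha, f.1, hf, by simp⟩

open Classical in
/-- The ordered pairs of adjacent nodes that lead from `S` to the complement of `S ∪ T`. -/
noncomputable def pairsBetween (S T : Finset V) : Finset (V × V) :=
  (pairsFrom G S).filter fun e => e.2 ∉ S ∧ e.2 ∉ T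

/-- Orient each cut edge away from `S`: it either ends outside `T` or is charged to the degree of
its endpoint in `T`. -/
theorem cutSize_le_card_pairsBetween_add (S T : Finset V) :
    cutSize G (S : Set V) ≤ (pairsBetween G S T).card + degSum G T := by
  classical
  have h1 : cutSize G (S : Set V) ≤ (pairsBetween G S T ∪
      (pairsFrom G T).image Prod.swap).card := by
    refine le_trans ?_ (Finset.card_image_le (f := fun e : V × V => s(e.1, e.2)))
    rw [cutSize, ← Set.ncard_coe_finset]
    refine Set.ncard_le_ncard ?_ (Set.toFinite _)
    rintro e ⟨he, ⟨x, hx, hxe⟩, y, hy, hye⟩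
    have hne : x ≠ y := fun h => hy (h ▸ hx)
    obtain rfl : e = s(x, y) := (Sym2.mem_and_mem_iff hne).1 ⟨hxe, hye⟩
    have ha : G.Adj x y := he
    simp only [Finset.coe_image, Set.mem_image, Finset.mem_coe, Finset.mem_union]
    refine ⟨(x, y), ?_, rfl⟩
    by_cases hT : y ∈ T
    · right
      exact Finset.mem_image.2 ⟨(y, x), by simp [pairsFrom, hT, ha.symm], rfl⟩
    · left
      have hy' : y ∉ S := hy
      have hx' : x ∈ S := hx
      simp [pairsBetween, pairsFrom, hx', hy', hT, ha]
  refine h1.trans ((Finset.card_union_le _ _).trans (Nat.add_le_add_left ?_ _))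
  exact Finset.card_image_le.trans (card_pairsFrom G T).le

theorem cutSize_le_min_vol {V : Type*} [Finite V] (G : SimpleGraph V) (S : Set V) :
    cutSize G S ≤ min (vol G S) (vol G Sᶜ) := by
  refine le_min ?_ ?_ <;> refine Set.ncard_le_ncard ?_ (Set.toFinite _)
  · exact fun e he => ⟨he.1, he.2.1⟩
  · exact fun e he => ⟨he.1, he.2.2⟩

theorem card_mul_minDegree_le_degSum (S : Finset V) : S.card * G.minDegree ≤ degSum G S := by
  rw [degSum, ← smul_eq_mul]
  exact Finset.card_nsmul_le_sum _ _ _ fun v _ => G.minDegree_le_degree v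

theorem degSum_le_card_sq (S : Finset V) : degSum G S ≤ Fintype.card V ^ 2 := by
  refine (Finset.sum_le_card_nsmul S _ (Fintype.card V) fun v _ =>
    (G.degree_lt_card_verts v).le).trans ?_
  rw [smul_eq_mul, sq]
  exact Nat.mul_le_mul_right _ (Finset.card_le_univ S)

theorem degSum_mono {S T : Finset V} (h : S ⊆ T) : degSum G S ≤ degSum G T :=
  Finset.sum_le_sum_of_subset h

theorem degSum_union_of_disjoint [DecidableEq V] {S T : Finset V} (h : Disjoint S T) :
    degSum G (S ∪ T) = degSum G S + degSum G T :=
  Finset.sum_union h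

theorem inter_nonempty_of_degSum [DecidableEq V] {S T : Finset V}
    (hS : degSum G Finset.univ < 2 * degSum G S) (hT : degSum G Finset.univ < 2 * degSum G T) :
    (S ∩ T).Nonempty := by
  by_contra h
  rw [Finset.not_nonempty_iff_eq_empty, ← Finset.disjoint_iff_inter_eq_empty] at h
  have := degSum_mono G (Finset.subset_univ (S ∪ T))
  rw [degSum_union_of_disjoint G h] at this
  omega

variable {G}

/-- A singleton with an incident edge is an admissible cut, and no conductance exceeds 1. -/
theorem IsExpander.le_one {V : Type*} [Finite V] {G : SimpleGraph V} {φ : ℝ} (hG : IsExpander G φ)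
    {x y : V} (h : G.Adj x y) : φ ≤ 1 := by
  have hx : 0 < vol G {x} := by
    rw [vol, Set.ncard_pos (Set.toFinite _)]
    exact ⟨s(x, y), h, x, rfl, by simp⟩
  have hy : 0 < vol G ({x} : Set V)ᶜ := by
    rw [vol, Set.ncard_pos (Set.toFinite _)]
    exact ⟨s(x, y), h, y, h.ne.symm, by simp⟩
  refine (hG {x} hx hy).trans (div_le_one_of_le₀ ?_ (Nat.cast_nonneg _))
  exact_mod_cast cutSize_le_min_vol G {x}

/-- Degree sums, unlike `vol`, are additive. The complement of `S` has at least the degree sum of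
`S`, so both volumes are at least half of `degSum G S`. -/
theorem IsExpander.degSum_le_cutSize {φ : ℝ} (hG : IsExpander G φ) (hφ : 0 < φ)
    {S : Finset V} (hS : 0 < degSum G S) (hhalf : 2 * degSum G S ≤ degSum G Finset.univ) :
    φ * degSum G S ≤ 2 * cutSize G (S : Set V) := by
  classical
  have hc : degSum G S ≤ degSum G Sᶜ := by
    have : degSum G S + degSum G Sᶜ = degSum G Finset.univ := Finset.sum_add_sum_compl S _
    omega
  have h1 := degSum_le_two_mul_vol G S
  have h2 := degSum_le_two_mul_vol G Sᶜ
  rw [Finset.coe_compl] at h2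
  have h := hG S (by omega) (by omega)
  have hpos : 0 < min (vol G (S : Set V)) (vol G (S : Set V)ᶜ) := by omega
  have hle : degSum G S ≤ 2 * min (vol G (S : Set V)) (vol G (S : Set V)ᶜ) := by omega
  rw [conductance, le_div_iff₀ (by exact_mod_cast hpos)] at h
  have hle' : (degSum G S : ℝ) ≤ 2 * (min (vol G (S : Set V)) (vol G (S : Set V)ᶜ) : ℕ) := by
    exact_mod_cast hle
  nlinarith

/-- At least `φ/2 * degSum G S` edges leave `S`, and `T` absorbs at most half of that. -/
theorem IsExpander.le_card_pairsBetween {φ : ℝ} (hG : IsExpander G φ) (hφ : 0 < φ)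
    {S T : Finset V} (hS : 0 < degSum G S) (hhalf : 2 * degSum G S ≤ degSum G Finset.univ)
    (hT : 4 * degSum G T ≤ φ * degSum G S) :
    φ * degSum G S ≤ 4 * (pairsBetween G S T).card := by
  have h1 := hG.degSum_le_cutSize hφ hS hhalf
  have h2 : (cutSize G (S : Set V) : ℝ) ≤ (pairsBetween G S T).card + degSum G T := by
    exact_mod_cast cutSize_le_card_pairsBetween_add G S T
  linarith

end DegreeSums

/-! ### Expanding relations and balls -/

section Balls

variable {V : Type*} [Fintype V]

/-- From every nonempty set `S` of at most half of the total degree the relation `R` leads out of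
`S ∪ T` for every `T` whose degree sum is at most `φ / 4` times that of `S`. -/
def Expands (G : SimpleGraph V) [DecidableRel G.Adj] (φ : ℝ) (R : V → V → Prop) : Prop :=
  ∀ S T : Finset V, S.Nonempty → 2 * degSum G S ≤ degSum G Finset.univ →
    4 * degSum G T ≤ φ * degSum G S → ∃ e ∈ pairsBetween G S T, R e.1 e.2

open Classical in
/-- The nodes that `R` reaches from `u` in at most `k` steps. -/
noncomputable def ball (R : V → V → Prop) (u : V) : ℕ → Finset V
  | 0 => {u}
  | k + 1 => ball R u k ∪ Finset.univ.filter fun y => ∃ x ∈ ball R u k, R x y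

theorem mem_ball_self (R : V → V → Prop) (u : V) (k : ℕ) : u ∈ ball R u k := by
  induction k with
  | zero => simp [ball]
  | succ k ih =>
    classical
    exact Finset.mem_union_left _ ih

variable {G : SimpleGraph V} [DecidableRel G.Adj]

theorem Expands.lt_degSum_ball_or {φ : ℝ} {R : V → V → Prop} (hR : Expands G φ R) (hφ : 0 < φ)
    (hdeg : 1 ≤ G.minDegree) (u : V) (k : ℕ) :
    degSum G Finset.univ < 2 * degSum G (ball R u k) ∨
      (1 + φ / 4) ^ k ≤ degSum G (ball R u k) := by
  classical
  induction k with
  | zero =>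
    right
    have := card_mul_minDegree_le_degSum G {u}
    rw [Finset.card_singleton, one_mul] at this
    simp only [pow_zero, ball]
    exact_mod_cast hdeg.trans this
  | succ k ih =>
    have hsub : ball R u k ⊆ ball R u (k + 1) := Finset.subset_union_left
    have hmono := degSum_mono G hsub
    by_cases hhalf : degSum G Finset.univ < 2 * degSum G (ball R u k)
    · left; omega
    right
    have hpow := ih.resolve_left hhalf
    have hunion : degSum G (ball R u (k + 1)) =
        degSum G (ball R u k) + degSum G (ball R u (k + 1) \ ball R u k) := by
      rw [← degSum_union_of_disjoint G Finset.disjoint_sdiff, Finset.union_sdiff_of_subset hsub]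
    -- Take `T` to be the new layer: were it light, `R` would lead out of the ball and the layer,
    -- yet every `R`-successor of the ball lies in one of them.
    have hgrow : φ * degSum G (ball R u k) < 4 * degSum G (ball R u (k + 1) \ ball R u k) := by
      by_contra hle
      obtain ⟨e, he, hRe⟩ := hR _ _ ⟨u, mem_ball_self R u k⟩ (not_lt.1 hhalf) (not_lt.1 hle)
      simp only [pairsBetween, pairsFrom, Finset.mem_filter, Finset.mem_product,
        Finset.mem_sdiff] at he
      refine he.2.2 ⟨?_, he.2.1⟩
      refine Finset.mem_union_right _ ?_
      simp only [Finset.mem_filter, Finset.mem_univ, true_and]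
      exact ⟨e.1, he.1.1.1, hRe⟩
    rw [hunion, pow_succ]
    push_cast
    nlinarith

theorem DiWalk.snoc {V : Type*} {D : Digraph V} {k : ℕ} {u v w : V} (p : DiWalk D k u v)
    (h : D.Adj v w) : DiWalk D (k + 1) u w := by
  induction p with
  | nil u => exact .cons h (.nil w)
  | cons h' _ ih => exact .cons h' (ih h)

theorem DiWalk.append {V : Type*} {D : Digraph V} {k l : ℕ} {u v w : V} (p : DiWalk D k u v)
    (q : DiWalk D l v w) : DiWalk D (l + k) u w := by
  induction p with
  | nil u => exact q
  | cons h _ ih => exact .cons h (ih q)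

theorem exists_diWalk_of_mem_ball (D : Digraph V) (u : V) (k : ℕ) {v : V}
    (hv : v ∈ ball D.Adj u k) : ∃ j ≤ k, DiWalk D j u v := by
  induction k generalizing v with
  | zero =>
    obtain rfl : v = u := by simpa [ball] using hv
    exact ⟨0, le_rfl, .nil _⟩
  | succ k ih =>
    simp only [ball, Finset.mem_union, Finset.mem_filter, Finset.mem_univ, true_and] at hv
    obtain hv | ⟨x, hx, hxv⟩ := hv
    · obtain ⟨j, hj, p⟩ := ih hv
      exact ⟨j, by omega, p⟩
    · obtain ⟨j, hj, p⟩ := ih hx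
      exact ⟨j + 1, by omega, p.snoc hxv⟩

theorem exists_diWalk_of_mem_ball_swap (D : Digraph V) (v : V) (k : ℕ) {u : V}
    (hu : u ∈ ball (fun x y => D.Adj y x) v k) : ∃ j ≤ k, DiWalk D j u v := by
  induction k generalizing u with
  | zero =>
    obtain rfl : u = v := by simpa [ball] using hu
    exact ⟨0, le_rfl, .nil _⟩
  | succ k ih =>
    simp only [ball, Finset.mem_union, Finset.mem_filter, Finset.mem_univ, true_and] at hu
    obtain hu | ⟨x, hx, hxu⟩ := hu
    · obtain ⟨j, hj, p⟩ := ih hu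
      exact ⟨j, by omega, p⟩
    · obtain ⟨j, hj, p⟩ := ih hx
      exact ⟨j + 1, by omega, .cons hxu p⟩

theorem DiWalk.exists_diDist_eq {V : Type*} {D : Digraph V} {k : ℕ} {u v : V}
    (p : DiWalk D k u v) : ∃ d : ℕ, diDist D u v = d ∧ d ≤ k := by
  have h : diDist D u v ≤ k := iInf₂_le k p
  obtain ⟨d, hd⟩ := ENat.ne_top_iff_exists.1 (ne_top_of_le_ne_top (ENat.natCast_ne_top k) h)
  refine ⟨d, hd.symm, ?_⟩
  rw [← hd] at h
  exact_mod_cast h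

theorem exists_diDist_le_of_expands {φ : ℝ} {D : Digraph V} (hD : Expands G φ D.Adj)
    (hD' : Expands G φ fun x y => D.Adj y x) (hφ : 0 < φ) (hφ1 : φ ≤ 1)
    (hdeg : 1 ≤ G.minDegree) (hn : 2 ≤ Fintype.card V) (u v : V) :
    ∃ d : ℕ, diDist D u v = d ∧ (d : ℝ) ≤ 40 * Real.log (Fintype.card V) / φ := by
  classical
  -- Lets the `+ 1` in the radius be absorbed by `2 log n / φ`.
  have hlog : 1 / 2 ≤ Real.log (Fintype.card V) := by
    have : Real.log 2 ≤ Real.log (Fintype.card V) :=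
      Real.log_le_log (by norm_num) (by exact_mod_cast hn)
    linarith [Real.log_two_gt_d9]
  have hn0 : (0 : ℝ) < Fintype.card V := by positivity
  set k : ℕ := ⌊16 * Real.log (Fintype.card V) / φ⌋₊ + 1 with hk
  have hk1 : 16 * Real.log (Fintype.card V) / φ < k := by
    rw [hk]; push_cast; exact Nat.lt_floor_add_one _
  have hk2 : (k : ℝ) ≤ 18 * Real.log (Fintype.card V) / φ := by
    have h1 : (⌊16 * Real.log (Fintype.card V) / φ⌋₊ : ℝ) ≤
        16 * Real.log (Fintype.card V) / φ := Nat.floor_le (by positivity)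
    have h2 : 1 ≤ 2 * Real.log (Fintype.card V) / φ := by
      rw [le_div_iff₀ hφ]; linarith
    have h3 : 18 * Real.log (Fintype.card V) / φ = 16 * Real.log (Fintype.card V) / φ +
      2 * Real.log (Fintype.card V) / φ := by ring
    rw [hk]; push_cast; linarith
  have hbig : (Fintype.card V : ℝ) ^ 2 < (1 + φ / 4) ^ k := by
    -- Follows from `exp x ≤ 1 / (1 - x)` at `x = φ / 8`. Hence `16 log n / φ` steps of growth reach
    -- `n ^ 2`, the bound on every degree sum.
    have h1 : Real.exp (φ / 8) ≤ 1 + φ / 4 := by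
      have := Real.exp_bound_div_one_sub_of_interval (x := φ / 8) (by positivity) (by linarith)
      refine this.trans ?_
      rw [div_le_iff₀ (by linarith)]
      nlinarith
    have h2 : Real.exp (k * (φ / 8)) ≤ (1 + φ / 4) ^ k := by
      rw [Real.exp_nat_mul]
      gcongr
    refine lt_of_lt_of_le ?_ h2
    rw [← Real.exp_log (pow_pos hn0 2), Real.exp_lt_exp, Real.log_pow]
    rw [div_lt_iff₀ hφ] at hk1
    push_cast
    linarith
  have hsmall : ∀ S : Finset V, ¬ (1 + φ / 4) ^ k ≤ (degSum G S : ℝ) := fun S h => by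
    have : (degSum G S : ℝ) ≤ (Fintype.card V : ℝ) ^ 2 := by
      exact_mod_cast degSum_le_card_sq G S
    linarith
  have hu := (hD.lt_degSum_ball_or hφ hdeg u k).resolve_right (hsmall _)
  have hv := (hD'.lt_degSum_ball_or hφ hdeg v k).resolve_right (hsmall _)
  obtain ⟨w, hw⟩ := inter_nonempty_of_degSum G hu hv
  rw [Finset.mem_inter] at hw
  obtain ⟨i, hi, p⟩ := exists_diWalk_of_mem_ball D u k hw.1
  obtain ⟨j, hj, q⟩ := exists_diWalk_of_mem_ball_swap D v k hw.2
  obtain ⟨d, hd, hle⟩ := (p.append q).exists_diDist_eq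
  refine ⟨d, hd, ?_⟩
  have h1 : (d : ℝ) ≤ k + k := by exact_mod_cast hle.trans (by omega)
  have h2 : 40 * Real.log (Fintype.card V) / φ = 2 * (18 * Real.log (Fintype.card V) / φ) +
      4 * Real.log (Fintype.card V) / φ := by ring
  have h3 : 0 ≤ 4 * Real.log (Fintype.card V) / φ := by positivity
  linarith

end Balls

/-! ### Random relations -/

section RandomRelations

open Classical in
theorem sum_pow_card_finset (α : Type*) [Fintype α] (x : ℝ) :
    ∑ S : Finset α, x ^ S.card = (1 + x) ^ Fintype.card α := by
  have := Fintype.sum_pow_mul_eq_add_pow α x 1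
  simpa [add_comm] using this

theorem one_add_pow_le_exp_mul {x : ℝ} (hx : 0 ≤ x) (n : ℕ) :
    (1 + x) ^ n ≤ Real.exp (n * x) := by
  rw [Real.exp_nat_mul]
  gcongr
  linarith [Real.add_one_le_exp x]

variable {V : Type*} [Fintype V] {G : SimpleGraph V} [DecidableRel G.Adj]
  {Ω : Type*} [MeasurableSpace Ω] {μ : Measure Ω} [IsProbabilityMeasure μ]

/-- Under `μ` the relation `R` contains every adjacent ordered pair of `G` with probability `p`,
independently for different pairs, as far as the avoidance of sets of pairs is concerned. -/
def HasAvoidanceProb (G : SimpleGraph V) (μ : Measure Ω) (p : ℝ) (R : Ω → V → V → Prop) : Prop :=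
  ∀ A : Finset (V × V), (∀ e ∈ A, G.Adj e.1 e.2) →
    μ.real {ω | ∀ e ∈ A, ¬ R ω e.1 e.2} = (1 - p) ^ A.card

/-- Transfers the forward expansion estimate to reversed edges, as needed for backward balls. -/
theorem HasAvoidanceProb.swap {V Ω : Type*} [MeasurableSpace Ω] {G : SimpleGraph V} {μ : Measure Ω}
    {p : ℝ} {R : Ω → V → V → Prop} (h : HasAvoidanceProb G μ p R) :
    HasAvoidanceProb G μ p fun ω x y => R ω y x := by
  intro A hA
  have := h (A.map (Equiv.prodComm V V).toEmbedding) (by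
    intro e he
    obtain ⟨f, hf, rfl⟩ := Finset.mem_map.1 he
    exact (hA f hf).symm)
  rw [Finset.card_map] at this
  rw [← this]
  congr 1
  ext ω
  simp only [Set.mem_ofPred_eq, Finset.forall_mem_map]
  rfl

/-- Both `1024 t L s` and `1024 t L τ` are at most `φ d`, since the minimum degree bounds the sizes
`s`, `τ` by the degree sums. Thus `1024 t L (s + τ) ≤ 2 φ d ≤ 8 m`. -/
theorem avoidance_exponent_le {φ d dT m s τ t Δ L : ℝ} (hφ : 0 < φ) (hφ1 : φ ≤ 1) (hL : 0 ≤ L)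
    (hs : 0 ≤ s) (hτ : 0 ≤ τ) (ht : 1 ≤ t) (hΔ : 1024 * t ^ 2 * L / φ ≤ Δ)
    (hm : φ * d ≤ 4 * m) (hd : s * Δ ≤ d) (hdT : τ * Δ ≤ dT) (hT : 4 * dT ≤ φ * d) :
    8 * (s + τ) * L ≤ 1 / 16 / t * m := by
  rw [div_le_iff₀ hφ] at hΔ
  have ht0 : 0 < t := by linarith
  -- Only one factor `t` of the degree assumption is used from here on.
  have hΔ' : 1024 * t * L ≤ Δ * φ := by nlinarith [mul_nonneg hL ht0.le]
  have hΔ0 : 0 ≤ Δ := by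
    by_contra hneg
    have : Δ * φ < 0 := mul_neg_of_neg_of_pos (not_le.1 hneg) hφ
    have : 0 ≤ 1024 * t * L := by positivity
    linarith
  have h1 : 1024 * t * L * s ≤ φ * d := by
    calc 1024 * t * L * s ≤ Δ * φ * s := by gcongr
      _ = φ * (s * Δ) := by ring
      _ ≤ φ * d := by gcongr
  have h2 : 1024 * t * L * τ ≤ φ * d := by
    calc 1024 * t * L * τ ≤ Δ * φ * τ := by gcongr
      _ ≤ Δ * 1 * τ := by gcongr
      _ ≤ 4 * (τ * Δ) := by nlinarith [mul_nonneg hΔ0 hτ]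
      _ ≤ φ * d := by linarith
  rw [div_div, one_div_mul_eq_div, le_div_iff₀ (by positivity)]
  nlinarith

theorem HasAvoidanceProb.measureReal_not_expands_le {φ : ℝ} {t : ℕ} {R : Ω → V → V → Prop}
    (h : HasAvoidanceProb G μ (1 / 16 / t) R) (hG : IsExpander G φ) (hφ : 0 < φ) (hφ1 : φ ≤ 1)
    (ht : 1 ≤ t) (hn : 2 ≤ Fintype.card V) (hdeg : 1 ≤ G.minDegree)
    (hΔ : 1024 * (t : ℝ) ^ 2 * Real.log (Fintype.card V) / φ ≤ G.minDegree) :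
    μ.real {ω | ¬ Expands G φ (R ω)} ≤ 1 / 16 := by
  classical
  have hn' : (2 : ℝ) ≤ Fintype.card V := by exact_mod_cast hn
  have hn0 : (0 : ℝ) < Fintype.card V := by linarith
  have ht' : (1 : ℝ) ≤ t := by exact_mod_cast ht
  set r : ℝ := (Fintype.card V : ℝ)⁻¹ with hr
  have hr0 : 0 < r := by positivity
  have hr2 : r ≤ 1 / 2 := by
    rw [hr, inv_le_comm₀ hn0 (by norm_num)]; linarith
  set P : Finset (Finset V × Finset V) := Finset.univ.filter fun q => q.1.Nonempty ∧
    2 * degSum G q.1 ≤ degSum G Finset.univ ∧ (4 * degSum G q.2 : ℝ) ≤ φ * degSum G q.1 with hP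
  have hpair : ∀ q ∈ P, μ.real {ω | ∀ e ∈ pairsBetween G q.1 q.2, ¬ R ω e.1 e.2} ≤
      r ^ 6 * ((r ^ 2) ^ q.1.card * (r ^ 2) ^ q.2.card) := by
    intro q hq
    obtain ⟨hne, hhalf, hT⟩ := (Finset.mem_filter.1 hq).2
    rw [h _ (fun e he => by
      simp only [pairsBetween, pairsFrom, Finset.mem_filter] at he
      exact he.1.2)]
    have hc1 := card_mul_minDegree_le_degSum G q.1
    have hc2 := card_mul_minDegree_le_degSum G q.2
    have hcard : 1 ≤ q.1.card := hne.card_pos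
    have hS : 0 < degSum G q.1 := lt_of_lt_of_le (Nat.mul_pos hcard hdeg) hc1
    have hm := hG.le_card_pairsBetween hφ hS hhalf hT
    have hexp := avoidance_exponent_le hφ hφ1 (Real.log_nonneg (by linarith))
      (Nat.cast_nonneg q.1.card) (Nat.cast_nonneg q.2.card) ht' hΔ hm
      (by exact_mod_cast hc1) (by exact_mod_cast hc2) hT
    have hp : (1 : ℝ) / 16 / t ≤ 1 := by
      rw [div_le_one (by linarith)]; linarith
    calc (1 - 1 / 16 / (t : ℝ)) ^ (pairsBetween G q.1 q.2).card
        ≤ Real.exp (-(1 / 16 / t)) ^ (pairsBetween G q.1 q.2).card :=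
          pow_le_pow_left₀ (by linarith) (Real.one_sub_le_exp_neg _) _
      _ = Real.exp (-(1 / 16 / t * (pairsBetween G q.1 q.2).card)) := by
          rw [← Real.exp_nat_mul]; ring_nf
      _ ≤ Real.exp ((8 * (q.1.card + q.2.card) : ℕ) * Real.log r) := by
          rw [Real.exp_le_exp, hr, Real.log_inv]
          push_cast
          linarith
      _ = r ^ (8 * (q.1.card + q.2.card)) := by
          rw [Real.exp_nat_mul, Real.exp_log hr0]
      -- As `S` is nonempty, a factor `r ^ 6` can be split off; the rest makes the sum over `(S, T)`
      -- factor into two binomial sums, each at most 2.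
      _ ≤ r ^ (6 + (2 * q.1.card + 2 * q.2.card)) :=
          pow_le_pow_of_le_one hr0.le (by linarith) (by omega)
      _ = _ := by rw [pow_add, pow_add, pow_mul, pow_mul]
  have hexp1 : (1 + r ^ 2) ^ Fintype.card V ≤ 2 := by
    refine (one_add_pow_le_exp_mul (by positivity) _).trans ?_
    have h1 : (Fintype.card V : ℝ) * r ^ 2 ≤ 1 / 2 := by
      rw [sq, ← mul_assoc, hr, mul_inv_cancel₀ hn0.ne', one_mul]; exact hr2
    refine (Real.exp_le_exp.2 h1).trans ?_
    have := Real.exp_bound_div_one_sub_of_interval (x := 1 / 2) (by norm_num) (by norm_num)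
    norm_num at this ⊢
    exact this
  calc μ.real {ω | ¬ Expands G φ (R ω)}
      ≤ μ.real (⋃ q ∈ P, {ω | ∀ e ∈ pairsBetween G q.1 q.2, ¬ R ω e.1 e.2}) := by
        refine measureReal_mono (fun ω hω => ?_) (measure_ne_top _ _)
        simp only [Set.mem_ofPred_eq, Expands] at hω
        push Not at hω
        obtain ⟨S, T, hS, hhalf, hT, hno⟩ := hω
        simp only [Set.mem_iUnion]
        exact ⟨(S, T), by simp [hP, hS, hhalf, hT], hno⟩
    _ ≤ ∑ q ∈ P, μ.real {ω | ∀ e ∈ pairsBetween G q.1 q.2, ¬ R ω e.1 e.2} :=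
        measureReal_biUnion_finset_le _ _
    _ ≤ ∑ q ∈ P, r ^ 6 * ((r ^ 2) ^ q.1.card * (r ^ 2) ^ q.2.card) := Finset.sum_le_sum hpair
    _ ≤ ∑ q : Finset V × Finset V, r ^ 6 * ((r ^ 2) ^ q.1.card * (r ^ 2) ^ q.2.card) :=
        Finset.sum_le_sum_of_subset_of_nonneg (Finset.subset_univ _)
          fun q _ _ => by positivity
    _ = r ^ 6 * ((1 + r ^ 2) ^ Fintype.card V * (1 + r ^ 2) ^ Fintype.card V) := by
        rw [← Finset.mul_sum, Fintype.sum_prod_type]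
        simp_rw [← Finset.mul_sum, ← Finset.sum_mul, sum_pow_card_finset]
    _ ≤ (1 / 2) ^ 6 * (2 * 2) := by gcongr
    _ = 1 / 16 := by norm_num

variable [DiscreteMeasurableSpace Ω]

theorem HasAvoidanceProb.measureReal_rel {V : Type*} {G : SimpleGraph V} {p : ℝ}
    {R : Ω → V → V → Prop}
    (h : HasAvoidanceProb G μ p R) {x y : V} (hxy : G.Adj x y) :
    μ.real {ω | R ω x y} = p := by
  have h1 := h {(x, y)} (by simpa using hxy)
  have h2 : {ω | ∀ e ∈ ({(x, y)} : Finset (V × V)), ¬ R ω e.1 e.2} = {ω | R ω x y}ᶜ := by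
    ext ω; simp
  rw [h2, probReal_compl_eq_one_sub (MeasurableSet.of_discrete)] at h1
  simp only [Finset.card_singleton, pow_one] at h1
  linarith

/-- Union bound over the two orientations of each edge. -/
theorem HasAvoidanceProb.measureReal_meets_le {V : Type*} [Fintype V] {G : SimpleGraph V}
    {p : ℝ} (hp : 0 ≤ p) {R : Ω → V → V → Prop}
    (h : HasAvoidanceProb G μ p R) {E' : Finset (Sym2 V)}
    (hE : (E' : Set (Sym2 V)) ⊆ G.edgeSet) :
    μ.real {ω | ∃ x y, s(x, y) ∈ E' ∧ R ω x y} ≤ 2 * E'.card * p := by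
  classical
  set A : Finset (V × V) := Finset.univ.filter fun e => s(e.1, e.2) ∈ E' with hA
  have hcard : A.card ≤ 2 * E'.card := by
    refine Finset.card_le_mul_card_image_of_maps_to (f := fun e : V × V => s(e.1, e.2))
      (fun e he => (Finset.mem_filter.1 he).2) 2 fun e _ => ?_
    induction e with
    | _ x y =>
      refine (Finset.card_le_card (t := {(x, y), (y, x)}) fun f hf => ?_).trans Finset.card_le_two
      simp only [Finset.mem_filter, Sym2.eq_iff] at hf
      simp only [Finset.mem_insert, Finset.mem_singleton, Prod.ext_iff]
      exact hf.2
  calc μ.real {ω | ∃ x y, s(x, y) ∈ E' ∧ R ω x y}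
      ≤ μ.real (⋃ e ∈ A, {ω | R ω e.1 e.2}) := by
        refine measureReal_mono ?_ (measure_ne_top _ _)
        rintro ω ⟨x, y, hxy, hR⟩
        simp only [Set.mem_iUnion]
        exact ⟨(x, y), by simpa [hA] using hxy, hR⟩
    _ ≤ ∑ e ∈ A, μ.real {ω | R ω e.1 e.2} := measureReal_biUnion_finset_le _ _
    _ = A.card * p := by
        rw [← nsmul_eq_mul]
        exact Finset.sum_eq_card_nsmul fun e he =>
          h.measureReal_rel (hE (Finset.mem_filter.1 he).2 : G.Adj e.1 e.2)
    _ ≤ 2 * E'.card * p := by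
        gcongr
        exact_mod_cast hcard

/-- The digraph `D` contains no edge of `E'` and has directed expansion both ways. -/
def IsGoodFor (G : SimpleGraph V) [DecidableRel G.Adj] (φ : ℝ) (E' : Finset (Sym2 V))
    (D : Digraph V) : Prop :=
  Expands G φ D.Adj ∧ Expands G φ (fun x y => D.Adj y x) ∧ ¬ ∃ x y, s(x, y) ∈ E' ∧ D.Adj x y

theorem HasAvoidanceProb.measureReal_not_isGoodFor_le {φ : ℝ} {t : ℕ} {D : Ω → Digraph V}
    (h : HasAvoidanceProb G μ (1 / 16 / t) fun ω => (D ω).Adj) (hG : IsExpander G φ)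
    (hφ : 0 < φ) (hφ1 : φ ≤ 1) (ht : 1 ≤ t) (hn : 2 ≤ Fintype.card V) (hdeg : 1 ≤ G.minDegree)
    (hΔ : 1024 * (t : ℝ) ^ 2 * Real.log (Fintype.card V) / φ ≤ G.minDegree)
    {E' : Finset (Sym2 V)} (hE : (E' : Set (Sym2 V)) ⊆ G.edgeSet) (hcard : E'.card ≤ 2 * t) :
    μ.real {ω | ¬ IsGoodFor G φ E' (D ω)} ≤ 1 / 2 := by
  have ht' : (0 : ℝ) < t := by exact_mod_cast ht
  have h1 := h.measureReal_not_expands_le hG hφ hφ1 ht hn hdeg hΔ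
  have h2 := h.swap.measureReal_not_expands_le hG hφ hφ1 ht hn hdeg hΔ
  have h3 : μ.real {ω | ∃ x y, s(x, y) ∈ E' ∧ (D ω).Adj x y} ≤ 1 / 4 := by
    refine (h.measureReal_meets_le (by positivity) hE).trans ?_
    have : (E'.card : ℝ) ≤ 2 * t := by exact_mod_cast hcard
    calc 2 * (E'.card : ℝ) * (1 / 16 / t) ≤ 2 * (2 * t) * (1 / 16 / t) := by gcongr
      _ = 1 / 4 := by field_simp; norm_num
  have hsub : {ω | ¬ IsGoodFor G φ E' (D ω)} ⊆ ({ω | ¬ Expands G φ (D ω).Adj} ∪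
      {ω | ¬ Expands G φ fun x y => (D ω).Adj y x}) ∪
      {ω | ∃ x y, s(x, y) ∈ E' ∧ (D ω).Adj x y} := by
    intro ω hω
    simp only [Set.mem_ofPred_eq, IsGoodFor, Set.mem_union] at hω ⊢
    tauto
  have h4 := measureReal_mono (μ := μ) hsub
  have h5 := measureReal_union_le (μ := μ) ({ω | ¬ Expands G φ (D ω).Adj} ∪
      {ω | ¬ Expands G φ fun x y => (D ω).Adj y x}) {ω | ∃ x y, s(x, y) ∈ E' ∧ (D ω).Adj x y}
  have h6 := measureReal_union_le (μ := μ) {ω | ¬ Expands G φ (D ω).Adj}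
      {ω | ¬ Expands G φ fun x y => (D ω).Adj y x}
  linarith

/-- Give each `E` the weight `M ^ (k - |E|)`, which is at least 1 on the sets counted; the total
weight is `M ^ k * (1 + 1/M) ^ |α|`. -/
theorem card_small_finsets_le {α : Type*} [Fintype α] {M : ℝ} (hM : 1 ≤ M)
    (hα : (Fintype.card α : ℝ) ≤ M) (k : ℕ) :
    ((Finset.univ.filter fun E : Finset α => E.card ≤ k).card : ℝ) ≤ M ^ k * Real.exp 1 := by
  classical
  have hM0 : 0 < M := by linarith
  calc ((Finset.univ.filter fun E : Finset α => E.card ≤ k).card : ℝ)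
      = ∑ E ∈ Finset.univ.filter (fun E : Finset α => E.card ≤ k), (1 : ℝ) := by simp
    _ ≤ ∑ E ∈ Finset.univ.filter (fun E : Finset α => E.card ≤ k), M ^ k * M⁻¹ ^ E.card := by
        refine Finset.sum_le_sum fun E hE => ?_
        rw [inv_pow, ← div_eq_mul_inv, one_le_div (by positivity)]
        exact pow_le_pow_right₀ hM (Finset.mem_filter.1 hE).2
    _ ≤ ∑ E : Finset α, M ^ k * M⁻¹ ^ E.card :=
        Finset.sum_le_sum_of_subset_of_nonneg (Finset.subset_univ _) fun E _ _ => by positivity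
    _ = M ^ k * (1 + M⁻¹) ^ Fintype.card α := by rw [← Finset.mul_sum, sum_pow_card_finset]
    _ ≤ M ^ k * Real.exp 1 := by
        gcongr
        refine (one_add_pow_le_exp_mul (by positivity) _).trans (Real.exp_le_exp.2 ?_)
        rw [← div_eq_mul_inv, div_le_one hM0]
        exact hα

/-- The union bound runs over `E'` only: a good digraph serves all pairs `u, v` at once. -/
theorem HasAvoidanceProb.measureReal_not_isDirectedCoveringFamily_le {φ : ℝ} {t l : ℕ}
    {D : Ω → Digraph V} (h : HasAvoidanceProb G μ (1 / 16 / t) fun ω => (D ω).Adj)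
    (hsub : ∀ ω u v, (D ω).Adj u v → G.Adj u v) (hG : IsExpander G φ)
    (hφ : 0 < φ) (hφ1 : φ ≤ 1) (ht : 1 ≤ t) (hn : 2 ≤ Fintype.card V) (hdeg : 1 ≤ G.minDegree)
    (hΔ : 1024 * (t : ℝ) ^ 2 * Real.log (Fintype.card V) / φ ≤ G.minDegree) :
    (Measure.pi fun _ : Fin l => μ).real {ω | ¬ IsDirectedCoveringFamily G
      (40 * Real.log (Fintype.card V) / φ) (2 * t) fun i => D (ω i)} ≤
      ((Fintype.card V : ℝ) ^ 2) ^ (2 * t) * Real.exp 1 * (1 / 2) ^ l := by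
  classical
  set P : Finset (Finset (Sym2 V)) := Finset.univ.filter fun E => E.card ≤ 2 * t with hP
  set Q : Finset (Finset (Sym2 V)) := P.filter fun E => (E : Set (Sym2 V)) ⊆ G.edgeSet with hQ
  have hn' : (1 : ℝ) ≤ Fintype.card V := by exact_mod_cast (by omega : 1 ≤ Fintype.card V)
  have hprob : ∀ E ∈ Q, (Measure.pi fun _ : Fin l => μ).real
      {ω | ∀ i, ¬ IsGoodFor G φ E (D (ω i))} ≤ (1 / 2) ^ l := by
    intro E hE
    obtain ⟨hE1, hE2⟩ := Finset.mem_filter.1 hE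
    have hset : {ω : Fin l → Ω | ∀ i, ¬ IsGoodFor G φ E (D (ω i))} =
        Set.pi Set.univ fun _ => {ω | ¬ IsGoodFor G φ E (D ω)} := by
      ext ω; simp
    rw [hset, measureReal_def, Measure.pi_pi, ENNReal.toReal_prod]
    simp only [Finset.prod_const, Finset.card_univ, Fintype.card_fin]
    exact pow_le_pow_left₀ ENNReal.toReal_nonneg
      (h.measureReal_not_isGoodFor_le hG hφ hφ1 ht hn hdeg hΔ hE2 (Finset.mem_filter.1 hE1).2) _
  have hsym : (Fintype.card (Sym2 V) : ℝ) ≤ (Fintype.card V : ℝ) ^ 2 := by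
    have : Fintype.card (Sym2 V) ≤ Fintype.card (V × V) :=
      Fintype.card_le_of_surjective (fun e : V × V => s(e.1, e.2))
        fun e => by induction e with | _ x y => exact ⟨(x, y), rfl⟩
    rw [Fintype.card_prod, ← sq] at this
    exact_mod_cast this
  calc (Measure.pi fun _ : Fin l => μ).real {ω | ¬ IsDirectedCoveringFamily G
          (40 * Real.log (Fintype.card V) / φ) (2 * t) fun i => D (ω i)}
      ≤ (Measure.pi fun _ : Fin l => μ).real
          (⋃ E ∈ Q, {ω | ∀ i, ¬ IsGoodFor G φ E (D (ω i))}) := by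
        refine measureReal_mono (fun ω hω => ?_) (measure_ne_top _ _)
        by_contra hcon
        simp only [Set.mem_iUnion, Set.mem_ofPred_eq, not_exists, not_forall, not_not] at hcon
        refine hω ⟨fun i => hsub (ω i), fun u v E hE hEc => ?_⟩
        obtain ⟨i, h1, h2, h3⟩ := hcon E (by simp [hQ, hP, hE, hEc])
        refine ⟨i, exists_diDist_le_of_expands h1 h2 hφ hφ1 hdeg hn u v, fun x y hxy => ?_⟩
        exact ⟨fun ha => h3 ⟨x, y, hxy, ha⟩, fun ha => h3 ⟨y, x, Sym2.eq_swap ▸ hxy, ha⟩⟩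
    _ ≤ ∑ E ∈ Q, (Measure.pi fun _ : Fin l => μ).real
          {ω | ∀ i, ¬ IsGoodFor G φ E (D (ω i))} := measureReal_biUnion_finset_le _ _
    _ ≤ ∑ E ∈ Q, (1 / 2 : ℝ) ^ l := Finset.sum_le_sum hprob
    _ = Q.card * (1 / 2 : ℝ) ^ l := by simp
    _ ≤ ((Fintype.card V : ℝ) ^ 2) ^ (2 * t) * Real.exp 1 * (1 / 2) ^ l := by
        gcongr
        refine le_trans ?_ (card_small_finsets_le (one_le_pow₀ hn') hsym (2 * t))
        exact_mod_cast Finset.card_filter_le _ _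

end RandomRelations

/-! ### The law of the sampled graphs -/

section Sampling

/-- Regroups coins from node by node to index by index, which exhibits the sampled digraphs as
independent. -/
theorem map_swap_pi_pi {ι κ : Type*} [Fintype ι] [Fintype κ] {X : ι → Type*} [∀ v, Finite (X v)]
    [∀ v, MeasurableSpace (X v)] [∀ v, MeasurableSingletonClass (X v)]
    (μ : ∀ v, Measure (X v)) [∀ v, IsProbabilityMeasure (μ v)] :
    (Measure.pi fun v => Measure.pi fun _ : κ => μ v).map (fun ω i v => ω v i) =
      Measure.pi fun _ : κ => Measure.pi μ := by
  refine Measure.ext_of_singleton fun η => ?_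
  rw [Measure.map_apply (Measurable.of_discrete) (measurableSet_singleton η)]
  have hpre : (fun (ω : ∀ v, κ → X v) i v => ω v i) ⁻¹' {η} =
      {fun v i => η i v} := by
    ext ω
    simp only [Set.mem_preimage, Set.mem_singleton_iff, funext_iff]
    exact forall_comm
  rw [hpre]
  simp only [Measure.pi_singleton]
  exact Finset.prod_comm

variable {V : Type*} [Fintype V] (G : SimpleGraph V) [DecidableRel G.Adj] (ident : V ↪ ℕ)

/-- The coins that the nodes toss for one index. -/
abbrev RoundCoins : Type _ := ∀ v : V, (view G ident v).nbrs → Bool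

/-- The law of the coins for one index. -/
noncomputable def roundLaw (p : unitInterval) : Measure (RoundCoins G ident) :=
  Measure.pi fun _ => Measure.pi fun _ => bernoulliMeasure true false p

instance (p : unitInterval) : IsProbabilityMeasure (roundLaw G ident p) := by
  unfold roundLaw; infer_instance

/-- The directed graph sampled for one index. -/
def roundGraph (ω : RoundCoins G ident) : Digraph V where
  Adj u v := ident u ∈ ((view G ident v).nbrs.attach.filter fun x => ω v x = true).map
    (Function.Embedding.subtype _)

theorem mem_nbrs_view {u v : V} : ident u ∈ (view G ident v).nbrs ↔ G.Adj u v := by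
  simp [view, SimpleGraph.adj_comm]

theorem roundGraph_adj {ω : RoundCoins G ident} {u v : V} :
    (roundGraph G ident ω).Adj u v ↔
      ∃ h : ident u ∈ (view G ident v).nbrs, ω v ⟨ident u, h⟩ = true := by
  simp [roundGraph]

/-- Avoiding `A` is a box event that forces one coin to `false` per pair in `A`; adjacency supplies
that coin, and injectivity of `ident` keeps the coins distinct. -/
theorem hasAvoidanceProb_roundLaw (p : unitInterval) :
    HasAvoidanceProb G (roundLaw G ident p) (p : ℝ) fun ω => (roundGraph G ident ω).Adj := by
  classical
  intro A hA
  have hset : {ω | ∀ e ∈ A, ¬ (roundGraph G ident ω).Adj e.1 e.2} =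
      Set.pi Set.univ fun v => Set.pi Set.univ fun x : (view G ident v).nbrs =>
        if ∃ u, (u, v) ∈ A ∧ ident u = x then {false} else Set.univ := by
    ext ω
    simp only [Set.mem_ofPred_eq, roundGraph_adj, Set.mem_pi, Set.mem_univ, true_implies]
    constructor
    · intro h v x
      split_ifs with hx
      · obtain ⟨u, hu, hux⟩ := hx
        have := h (u, v) hu
        simp only [not_exists, Bool.not_eq_true] at this
        have h' := this (hux ▸ x.2)
        rw [Set.mem_singleton_iff, ← h']
        exact congrArg _ (Subtype.ext hux.symm)
      · trivial
    · rintro h ⟨u, v⟩ hu ⟨hm, ht⟩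
      have := h v ⟨ident u, hm⟩
      rw [if_pos ⟨u, hu, rfl⟩, Set.mem_singleton_iff] at this
      simp only [this] at ht
      exact Bool.noConfusion ht
  have hb : ∀ (q : Prop) [Decidable q],
      (bernoulliMeasure true false p (if q then {false} else Set.univ)).toReal =
      if q then 1 - (p : ℝ) else 1 := by
    intro q _
    split_ifs
    · rw [← measureReal_def,
        bernoulliMeasure_real_apply_of_notMem_of_mem _ (measurableSet_singleton _)
        (by simp) (by simp)]
    · simp
  rw [hset, measureReal_def, roundLaw, Measure.pi_pi, ENNReal.toReal_prod]
  simp only [Measure.pi_pi, ENNReal.toReal_prod, hb]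
  simp only [Finset.prod_ite, Finset.prod_const, one_pow, mul_one]
  rw [Finset.prod_pow_eq_pow_sum, Finset.card_eq_sum_card_fiberwise (f := Prod.snd)
    (t := Finset.univ) (fun _ _ => Finset.mem_coe.2 (Finset.mem_univ _))]
  congr 1
  refine Finset.sum_congr rfl fun v _ => ?_
  symm
  refine Finset.card_bij (fun e he => ⟨ident e.1, ?_⟩) ?_ ?_ ?_
  · obtain ⟨h1, rfl⟩ := Finset.mem_filter.1 he
    exact (mem_nbrs_view G ident).2 (hA e h1)
  · intro e he
    obtain ⟨h1, rfl⟩ := Finset.mem_filter.1 he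
    simp only [Finset.mem_filter, Finset.mem_univ, true_and]
    exact ⟨e.1, h1, rfl⟩
  · intro e he f hf hef
    rw [Subtype.mk.injEq] at hef
    exact Prod.ext (ident.injective hef)
      ((Finset.mem_filter.1 he).2.trans (Finset.mem_filter.1 hf).2.symm)
  · intro x hx
    obtain ⟨u, hu, hux⟩ := (Finset.mem_filter.1 hx).2
    exact ⟨(u, v), by simp [hu], Subtype.ext hux⟩

theorem measureReal_sampling_eq (cp Cl : ℝ) (N t : ℕ) (F : Finset (Sym2 V))
    (adv : (sampling cp Cl N t).Adversary G ident)
    (Q : (Fin (numSubgraphs Cl N t) → Digraph V) → Prop) :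
    ((sampling cp Cl N t).coinsLaw G ident).real
        {ω | Q (outputFamily ident ((sampling cp Cl N t).outputAt G ident F adv ω))} =
      (Measure.pi fun _ : Fin (numSubgraphs Cl N t) => roundLaw G ident (rate cp t)).real
        {η | Q fun i => roundGraph G ident (η i)} := by
  have h := map_swap_pi_pi (κ := Fin (numSubgraphs Cl N t)) fun v : V =>
    Measure.pi fun _ : (view G ident v).nbrs => bernoulliMeasure true false (rate cp t)
  unfold roundLaw
  rw [← h, map_measureReal_apply (Measurable.of_discrete) (MeasurableSet.of_discrete)]
  -- With zero rounds the output is the initial state, so `F` and `adv` disappear by unfolding.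
  rfl

end Sampling

/-! ### Constants and conclusion -/

theorem coe_rate {t : ℕ} (ht : 1 ≤ t) : (rate (1 / 16) t : ℝ) = 1 / 16 / t := by
  have ht' : (1 : ℝ) ≤ t := by exact_mod_cast ht
  rw [rate, Set.projIcc_of_mem]
  refine ⟨by positivity, ?_⟩
  rw [div_le_one (by linarith)]
  linarith

theorem numSubgraphs_le {a Cl : ℝ} (ha : 1 ≤ a) (hCl : 0 < Cl) {n N t : ℕ} (ht : 1 ≤ t)
    (hN : (N : ℝ) ≤ (n : ℝ) ^ a) :
    (numSubgraphs Cl N t : ℝ) ≤ (Cl * a + 2) * t * Real.log n := by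
  have ht' : (1 : ℝ) ≤ t := by exact_mod_cast ht
  rcases Nat.lt_or_ge n 2 with hn | hn
  · have hN1 : N ≤ 1 := by
      have : (N : ℝ) ≤ 1 := hN.trans
        (Real.rpow_le_one (Nat.cast_nonneg n) (by exact_mod_cast (by omega : n ≤ 1)) (by linarith))
      exact_mod_cast this
    -- `Real.log 0 = 0` covers the empty graph.
    have h1 : Real.log N = 0 := by interval_cases N <;> simp
    have h2 : Real.log n = 0 := by interval_cases n <;> simp
    simp [numSubgraphs, h1, h2]
  · have hn' : (2 : ℝ) ≤ n := by exact_mod_cast hn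
    have hlog : 1 / 2 ≤ Real.log n := by
      have := Real.log_le_log (by norm_num) hn'
      linarith [Real.log_two_gt_d9]
    have hlogN : Real.log N ≤ a * Real.log n := by
      rcases Nat.eq_zero_or_pos N with rfl | hN0
      · simp only [Nat.cast_zero, Real.log_zero]
        nlinarith
      · rw [← Real.log_rpow (by linarith)]
        exact Real.log_le_log (by exact_mod_cast hN0) hN
    have h1 : (numSubgraphs Cl N t : ℝ) ≤ Cl * t * Real.log N + 1 :=
      (Nat.ceil_lt_add_one (by have := Real.log_natCast_nonneg N; positivity)).le
    have h2 : Cl * t * Real.log N ≤ Cl * t * (a * Real.log n) := by gcongr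
    nlinarith

/-- In `6 + c`, the 4 pays for `n ^ (4t)`, the 2 for the factor `e` (as `1 ≤ 2 t log n`), and `c`
remains; the outer 2 compensates `1/2 ≤ exp (-1/2)`. -/
theorem failure_bound_le {c : ℝ} (hc : 0 < c) {n N t : ℕ} (ht : 1 ≤ t) (hn : 2 ≤ n)
    (hN : n ≤ N) :
    ((n : ℝ) ^ 2) ^ (2 * t) * Real.exp 1 * (1 / 2) ^ numSubgraphs (2 * (6 + c)) N t ≤
      1 / (n : ℝ) ^ c := by
  have ht' : (1 : ℝ) ≤ t := by exact_mod_cast ht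
  have hn' : (2 : ℝ) ≤ n := by exact_mod_cast hn
  have hn0 : (0 : ℝ) < n := by linarith
  set L := Real.log n with hL
  have hlog : 1 / 2 ≤ L := by
    have := Real.log_le_log (by norm_num) hn'
    linarith [Real.log_two_gt_d9]
  have hLN : L ≤ Real.log N := Real.log_le_log hn0 (by exact_mod_cast hN)
  set l := numSubgraphs (2 * (6 + c)) N t with hl
  have hl1 : 2 * (6 + c) * t * L ≤ l := by
    refine le_trans ?_ (Nat.le_ceil (2 * (6 + c) * t * Real.log N))
    gcongr
  have h1 : ((n : ℝ) ^ 2) ^ (2 * t) = Real.exp (4 * t * L) := by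
    rw [← pow_mul, ← Real.exp_log (pow_pos hn0 _), Real.log_pow, ← hL]
    push_cast
    ring_nf
  have h2 : (1 / 2 : ℝ) ^ l ≤ Real.exp (-(l / 2)) := by
    have : (1 / 2 : ℝ) ≤ Real.exp (-(1 / 2)) := by
      linarith [Real.add_one_le_exp (-(1 / 2 : ℝ))]
    calc (1 / 2 : ℝ) ^ l ≤ Real.exp (-(1 / 2)) ^ l := by gcongr
      _ = Real.exp (-(l / 2)) := by rw [← Real.exp_nat_mul]; ring_nf
  have h3 : 1 / (n : ℝ) ^ c = Real.exp (-(c * L)) := by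
    rw [Real.rpow_def_of_pos hn0, one_div, ← Real.exp_neg, ← hL, mul_comm c]
  rw [h1, h3]
  calc Real.exp (4 * t * L) * Real.exp 1 * (1 / 2) ^ l
      ≤ Real.exp (4 * t * L) * Real.exp 1 * Real.exp (-(l / 2)) := by gcongr
    _ = Real.exp (4 * t * L + 1 + -(l / 2)) := by rw [Real.exp_add, Real.exp_add]
    _ ≤ Real.exp (-(c * L)) := by
        rw [Real.exp_le_exp]
        have h4 : 2 * L ≤ 2 * t * L := by nlinarith
        have h5 : c * L ≤ c * t * L := by
          have : c * L * 1 ≤ c * L * t := by gcongr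
          linarith
        nlinarith

end AdvCongest

theorem mainTheorem6 (a c : ℝ) (ha : 1 ≤ a) (hc : 0 < c) :
    ∃ Cdeg cp Cl Cnum CL : ℝ, 0 < Cdeg ∧ 0 < cp ∧ 0 < Cl ∧ 0 < Cnum ∧ 0 < CL ∧
      ∀ (V : Type u) [Fintype V] (G : SimpleGraph V) [DecidableRel G.Adj]
        (ident : V ↪ ℕ) (N t : ℕ) (φ : ℝ),
        1 ≤ t → 0 < φ →
        Fintype.card V ≤ N → (N : ℝ) ≤ (Fintype.card V : ℝ) ^ a →
        AdvCongest.IsExpander G φ →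
        Cdeg * (t : ℝ) ^ 2 * Real.log (Fintype.card V) / φ ≤ (G.minDegree : ℝ) →
        (AdvCongest.numSubgraphs Cl N t : ℝ) ≤ Cnum * t * Real.log (Fintype.card V) ∧
        ∀ (F : Finset (Sym2 V)), (F : Set (Sym2 V)) ⊆ G.edgeSet → F.card ≤ t →
        ∀ adv : (AdvCongest.sampling cp Cl N t).Adversary G ident,
          1 - 1 / (Fintype.card V : ℝ) ^ c ≤
            ((AdvCongest.sampling cp Cl N t).coinsLaw G ident).real
              {ω | AdvCongest.IsDirectedCoveringFamily G
                (CL * Real.log (Fintype.card V) / φ) (2 * t)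
                (AdvCongest.outputFamily ident
                  ((AdvCongest.sampling cp Cl N t).outputAt G ident F adv ω))} := by
  refine ⟨1024, 1 / 16, 2 * (6 + c), 2 * (6 + c) * a + 2, 40, by norm_num, by norm_num,
    by positivity, by positivity, by norm_num, ?_⟩
  intro V _ G _ ident N t φ ht hφ hnN hNa hG hΔ
  refine ⟨AdvCongest.numSubgraphs_le ha (by positivity) ht hNa, ?_⟩
  intro F _ _ adv
  rw [AdvCongest.measureReal_sampling_eq G ident (1 / 16) (2 * (6 + c)) N t F adv
    (AdvCongest.IsDirectedCoveringFamily G (40 * Real.log (Fintype.card V) / φ) (2 * t))]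
  obtain hn | hn | hn : Fintype.card V = 0 ∨ Fintype.card V = 1 ∨ 2 ≤ Fintype.card V := by omega
  -- Here `0 ^ c = 0` and `1 / 0 = 0`, so the required probability is 1.
  · have hempty : IsEmpty V := Fintype.card_eq_zero_iff.1 hn
    have huniv : {η : Fin (AdvCongest.numSubgraphs (2 * (6 + c)) N t) →
        AdvCongest.RoundCoins G ident | AdvCongest.IsDirectedCoveringFamily G
          (40 * Real.log (Fintype.card V) / φ) (2 * t)
          fun i => AdvCongest.roundGraph G ident (η i)} = Set.univ :=
      Set.eq_univ_of_forall fun η => ⟨fun _ u => hempty.elim u, fun u => hempty.elim u⟩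
    rw [huniv, probReal_univ, hn]
    simp [Real.zero_rpow hc.ne']
  -- The required probability is `1 - 1 = 0`.
  · rw [hn]
    simp
  · have hn' : (2 : ℝ) ≤ Fintype.card V := by exact_mod_cast hn
    have hlog : 0 < Real.log (Fintype.card V) := Real.log_pos (by linarith)
    have hdeg : 1 ≤ G.minDegree := by
      have ht' : (1 : ℝ) ≤ t := by exact_mod_cast ht
      have : (0 : ℝ) < G.minDegree := lt_of_lt_of_le (by positivity) hΔ
      exact_mod_cast this
    have hφ1 : φ ≤ 1 := by
      obtain ⟨x⟩ : Nonempty V := Fintype.card_pos_iff.1 (by omega)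
      obtain ⟨y, hy⟩ := (G.degree_pos_iff_exists_adj x).1 (hdeg.trans (G.minDegree_le_degree x))
      exact hG.le_one hy
    have hp := AdvCongest.hasAvoidanceProb_roundLaw G ident (AdvCongest.rate (1 / 16) t)
    rw [AdvCongest.coe_rate ht] at hp
    have hfail := hp.measureReal_not_isDirectedCoveringFamily_le
      (l := AdvCongest.numSubgraphs (2 * (6 + c)) N t)
      (fun ω u v h => (AdvCongest.mem_nbrs_view G ident).1
        ((AdvCongest.roundGraph_adj G ident).1 h).1) hG hφ hφ1 ht hn hdeg hΔ
    have hcompl := probReal_compl_eq_one_sub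
      (μ := Measure.pi fun _ : Fin (AdvCongest.numSubgraphs (2 * (6 + c)) N t) =>
        AdvCongest.roundLaw G ident (AdvCongest.rate (1 / 16) t))
      (s := {η | AdvCongest.IsDirectedCoveringFamily G (40 * Real.log (Fintype.card V) / φ) (2 * t)
        fun i => AdvCongest.roundGraph G ident (η i)}) MeasurableSet.of_discrete
    rw [Set.compl_ofPred] at hcompl
    linarith [AdvCongest.failure_bound_le hc ht hn hnN]
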